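/- For real numbers $0\le s<t$ and $x$, let $Q_n(y)=Q_n(y|x,s,t)$ be the monic polynomials in $y$ given by $Q_0=1$, $Q_1(y)=y-x$ and, for $n\ge 1$, $$yQ_n(y)=Q_{n+1}(y)+x q^n Q_n(y)+(t-sq^{n-1})[n]_q\,Q_{n-1}(y),\qquad [n]_q=\sum_{j=0}^{n-1}q^j ,\qquad q^0=1 .$$ The transition probability $P_{s,t}(x,dy)$ of the $q$-Wiener process is the orthogonality measure of $(Q_n)_{n\ge0}$, that is, the probability measure with all moments finite with respect to which these polynomials are pairwise orthogonal. Take $q=0$; then $P_{s,t}(x,dy)$ exists and is unique. For $t>0$ let the left and right generators be $$(\mathbb A_t^-f)(x)=\lim_{h\to0^+}\frac1h\Big(\int f(y)\,P_{t-h,t}(x,dy)-f(x)\Big),\qquad (\mathbb A_t^+f)(x)=\lim_{h\to0^+}\frac1h\Big(\int f(y)\,P_{t,t+h}(x,dy)-f(x)\Big).$$ A bounded continuous $f$ belongs to the domain of the weak left (respectively right) generator if the limit exists for every $x\in\mathbb R$ and the expression under the limit is bounded uniformly in $x\in\mathbb R$ and in $0<h\le t$ (respectively $h>0$). On polynomials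 the generators are defined by the pointwise limits, and their values are polynomials. **Corollary (generator of free Brownian motion).** Let $q=0$ and $t>0$. If $f:\mathbb R\to\mathbb R$ is a bounded continuous function with bounded continuous second derivative, then $f$ is in the domains of both weak generators, and for every $x\in\mathbb R$ $$(\mathbb A_t^{-}f)(x)=(\mathbb A_t^{+}f)(x)=\int_{(-2,2)}\left(\frac{\partial}{\partial x}\,\frac{f(\sqrt t\,y)-f(x)}{\sqrt t\,y-x}\right)\frac{\sqrt{4-y^2}}{2\pi}\,dy ,$$ where the integral converges absolutely. If $f$ is a polynomial, then both limits exist for every $x$ and are given by the same (absolutely convergent) integral, which is a polynomial in $x$. -/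

import Mathlib

open MeasureTheory Set Filter Topology Polynomial
open scoped BoundedContinuousFunction

noncomputable section

namespace QMeixner

/-- The `q`-integer `[n]_q = 1 + q + ... + q^(n-1)`. -/
def qInt (q : ℝ) (n : ℕ) : ℝ := ∑ j ∈ Finset.range n, q ^ j

/-- The monic polynomials `Q_n(y|x,s,t)` in the variable `y`, with `Q_{-1} = 0`, `Q_0 = 1` and, for
`n ≥ 1`,
`y Q_n = Q_{n+1} + (θ [n]_q + x q^n) Q_n + (t - s q^(n-1) + τ [n-1]_q) [n]_q Q_{n-1}`;
moreover `Q_1 = y - x`. -/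
def poly (q θ τ s t x : ℝ) : ℕ → ℝ[X]
  | 0 => 1
  | 1 => X - C x
  | n + 2 =>
      (X - C (θ * qInt q (n + 1) + x * q ^ (n + 1))) * poly q θ τ s t x (n + 1)
        - C ((t - s * q ^ n + τ * qInt q n) * qInt q (n + 1)) * poly q θ τ s t x n

/-- `μ` is a probability measure with all moments finite for which the polynomials `Q n` are
pairwise orthogonal. -/
structure IsOrthogonalityMeasure (Q : ℕ → ℝ[X]) (μ : Measure ℝ) : Prop where
  isProbabilityMeasure : IsProbabilityMeasure μ
  integrable_eval : ∀ p : ℝ[X], Integrable (fun y => p.eval y) μ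
  integral_mul_eq_zero : ∀ m n : ℕ, m ≠ n → ∫ y, (Q m).eval y * (Q n).eval y ∂μ = 0

open Classical in
/-- The transition probability `P_{s,t}(x, dy)` of the `q`-Meixner process with parameters `θ`, `τ`:
the orthogonality measure of the polynomials `Q_n(y|x,s,t)`. -/
def transition (q θ τ s t x : ℝ) : Measure ℝ :=
  if h : ∃ μ, IsOrthogonalityMeasure (poly q θ τ s t x) μ then h.choose else 0

/-- The polynomials of the `q`-Wiener process, that is the case `θ = τ = 0`. -/
def wienerPoly (q s t x : ℝ) : ℕ → ℝ[X] := poly q 0 0 s t x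

/-- The transition probability `P_{s,t}(x, dy)` of the `q`-Wiener process (`θ = τ = 0`). -/
def wienerTransition (q s t x : ℝ) : Measure ℝ := transition q 0 0 s t x

/-- The difference quotient `h⁻¹ (∫ f(y) P_{t-h,t}(x, dy) - f(x))`. -/
def leftQuotient (P : ℝ → ℝ → ℝ → Measure ℝ) (t : ℝ) (f : ℝ → ℝ) (h x : ℝ) : ℝ :=
  h⁻¹ * ((∫ y, f y ∂(P (t - h) t x)) - f x)

/-- The difference quotient `h⁻¹ (∫ f(y) P_{t,t+h}(x, dy) - f(x))`. -/
def rightQuotient (P : ℝ → ℝ → ℝ → Measure ℝ) (t : ℝ) (f : ℝ → ℝ) (h x : ℝ) : ℝ :=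
  h⁻¹ * ((∫ y, f y ∂(P t (t + h) x)) - f x)

/-- `f` is in the domain of the weak left infinitesimal generator at time `t` of the process on the
time axis `[0, ∞)` with transition probabilities `P`, and the generator maps `f` to `g`. -/
def HasWeakLeftGenerator (P : ℝ → ℝ → ℝ → Measure ℝ) (t : ℝ) (f : ℝ →ᵇ ℝ) (g : ℝ → ℝ) : Prop :=
  (∃ K : ℝ, ∀ h : ℝ, 0 < h → h ≤ t → ∀ x : ℝ, |leftQuotient P t f h x| ≤ K) ∧
  ∀ x : ℝ, Tendsto (fun h => leftQuotient P t f h x) (𝓝[>] 0) (𝓝 (g x))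

/-- `f` is in the domain of the weak right infinitesimal generator at time `t` of the process on the
time axis `[0, ∞)` with transition probabilities `P`, and the generator maps `f` to `g`. -/
def HasWeakRightGenerator (P : ℝ → ℝ → ℝ → Measure ℝ) (t : ℝ) (f : ℝ →ᵇ ℝ) (g : ℝ → ℝ) : Prop :=
  (∃ K : ℝ, ∀ h : ℝ, 0 < h → ∀ x : ℝ, |rightQuotient P t f h x| ≤ K) ∧
  ∀ x : ℝ, Tendsto (fun h => rightQuotient P t f h x) (𝓝[>] 0) (𝓝 (g x))

/-- The left generator at time `t`, acting on polynomials, maps `f` to `g` (pointwise limit). -/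
def HasPolyLeftGenerator (P : ℝ → ℝ → ℝ → Measure ℝ) (t : ℝ) (f g : ℝ[X]) : Prop :=
  ∀ x : ℝ, Tendsto (fun h => leftQuotient P t (fun y => f.eval y) h x) (𝓝[>] 0) (𝓝 (g.eval x))

/-- The right generator at time `t`, acting on polynomials, maps `f` to `g` (pointwise limit). -/
def HasPolyRightGenerator (P : ℝ → ℝ → ℝ → Measure ℝ) (t : ℝ) (f g : ℝ[X]) : Prop :=
  ∀ x : ℝ, Tendsto (fun h => rightQuotient P t (fun y => f.eval y) h x) (𝓝[>] 0) (𝓝 (g.eval x))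

/-- `∂/∂x [(f(√t y) - f(x)) / (√t y - x)] * √(4 - y²) / (2π)`. -/
def freeIntegrand (t : ℝ) (f : ℝ → ℝ) (x y : ℝ) : ℝ :=
  deriv (fun z : ℝ => (f (√t * y) - f z) / (√t * y - z)) x * (√(4 - y ^ 2) / (2 * Real.pi))

end QMeixner

end

/-! The law P_{s,t}(x, dy) has mean x and variance t - s. Write f(y) = f(x) + f'(x)(y - x) + (y -
x)² T(y), where T extends continuously to y = x. The linear term integrates to zero, so each
difference quotient is the integral of T against the probability measure (y - x)² P_{s,t}(x, dy) /
(t - s). The bound on f'' bounds T, which gives the uniform bound. By the quotient rule T(y) is the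
x-derivative of (f(y) - f(x)) / (y - x), so it remains to show that the weighted measures converge
to the semicircle law of variance t₀ when s and t tend to t₀.

For q = 0 the recurrence has constant coefficients after its first steps, so Q_{n+2} = (y - x)
U_{n+1} - (t - s) U_n, where the U_n are the orthogonal polynomials of the semicircle law of
variance t (`wienerPoly_zero_add_two`). Hence (y - x)² U_{n+2} = Q_1 Q_{n+3} + (t - s) Q_{n+2} + (t
- s)² U_n. By orthogonality the weighted measure gives U_{n+2} the integral (t - s) ∫ U_n dP, which
tends to 0; U_0 and U_1 give 1 and 0. These are the semicircle values, and Weierstrass approximation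
on a common compact support passes from polynomials to T (`tendsto_inv_mul_integral_sub_sq_mul`).

The measure itself is the spectral measure of a bounded Jacobi operator. Its compact support makes
it determined by its moments, so the support bound holds for whichever orthogonality measure
`transition` selects. -/

/-! ### Spectral measure of a bounded self-adjoint operator -/

theorem IsSelfAdjoint.aeval_polynomial {A : Type*} [Ring A] [StarRing A] [Algebra ℝ A]
    [StarModule ℝ A] {a : A} (ha : IsSelfAdjoint a) (p : ℝ[X]) : IsSelfAdjoint (aeval a p) := by
  induction p using Polynomial.induction_on' with
  | add p q hp hq => rw [map_add]; exact hp.add hq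
  | monomial n c =>
    rw [aeval_monomial, ← Algebra.smul_def]
    exact (IsSelfAdjoint.all c).smul (ha.pow n)

open scoped InnerProductSpace CompactlySupported in
-- The functional f ↦ Re ⟨e, f(J) e⟩ is positive on the continuous functions on the spectrum. The
-- Riesz–Markov theorem represents it by a measure, which is pushed forward to ℝ.
theorem exists_spectral_measure {H : Type*} [NormedAddCommGroup H] [InnerProductSpace ℂ H]
    [CompleteSpace H] (J : H →L[ℂ] H) (hJ : IsSelfAdjoint J) (e : H) (he : ‖e‖ = 1) :
    ∃ μ : Measure ℝ, IsProbabilityMeasure μ ∧ (∀ᵐ y ∂μ, |y| ≤ ‖J‖) ∧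
      ∀ p : ℝ[X], ∫ y, p.eval y ∂μ = (⟪e, aeval J p e⟫_ℂ).re := by
  have : Nontrivial H := ⟨e, 0, by rintro rfl; simp at he⟩
  let Φ : C(spectrum ℝ J, ℝ) →ₗ[ℝ] ℝ :=
    { toFun := fun f => (⟪e, cfcHom hJ f e⟫_ℂ).re
      map_add' := fun f g => by simp
      map_smul' := fun c f => by simp }
  let Λ : C_c(spectrum ℝ J, ℝ) →ₚ[ℝ] ℝ := PositiveLinearMap.mk₀
    { toFun := fun f => Φ f
      map_add' := fun f g => Φ.map_add f g
      map_smul' := fun c f => Φ.map_smul c f }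
    (fun f hf => by
      have h1 : 0 ≤ cfcHom hJ (f : C(spectrum ℝ J, ℝ)) := by
        rw [cfcHom_nonneg_iff]; exact hf
      have h2 := (ContinuousLinearMap.nonneg_iff_isPositive _).1 h1
      have h3 := h2.re_inner_nonneg_right e
      exact h3)
  let ν := RealRMK.rieszMeasure Λ
  have hν : ∀ f : C(spectrum ℝ J, ℝ), ∫ y, f y ∂ν = (⟪e, cfcHom hJ f e⟫_ℂ).re := by
    intro f
    exact RealRMK.integral_rieszMeasure Λ
      (CompactlySupportedContinuousMap.continuousMapEquiv f)
  have hνfin : IsFiniteMeasure ν := inferInstance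
  have hνp : IsProbabilityMeasure ν := by
    have h1 := hν 1
    rw [map_one] at h1
    simp [he, Measure.real] at h1
    constructor
    rw [← ENNReal.toReal_eq_one_iff]
    exact h1
  have hm : Measurable (Subtype.val : spectrum ℝ J → ℝ) := measurable_subtype_coe
  refine ⟨ν.map Subtype.val, Measure.isProbabilityMeasure_map hm.aemeasurable, ?_, ?_⟩
  · rw [ae_map_iff hm.aemeasurable (measurableSet_le (by fun_prop) (by fun_prop))]
    refine Eventually.of_forall fun y => ?_
    exact spectrum.norm_le_norm_of_mem y.2
  · intro p
    rw [integral_map hm.aemeasurable p.continuous.aestronglyMeasurable]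
    have h1 := hν (p.toContinuousMapOn _)
    have h2 : cfcHom hJ (p.toContinuousMapOn (spectrum ℝ J)) = aeval J p := by
      rw [← cfc_polynomial p J hJ, cfc_apply _ _ hJ]
      rfl
    rw [h2] at h1
    exact h1

/-! ### The recurrence at q = 0 -/

namespace QMeixner

theorem qInt_zero_succ (n : ℕ) : qInt 0 (n + 1) = 1 := by
  simp [qInt, Finset.sum_range_succ']

theorem wienerPoly_zero_zero (s t x : ℝ) : wienerPoly 0 s t x 0 = 1 := rfl

theorem wienerPoly_zero_one (s t x : ℝ) : wienerPoly 0 s t x 1 = X - C x := rfl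

/-- This is the only step where s enters, through 0 ^ 0 = 1; all later steps have the constant
coefficient t. -/
theorem wienerPoly_zero_two (s t x : ℝ) :
    wienerPoly 0 s t x 2 = X * (X - C x) - C (t - s) := by
  simp [wienerPoly, poly, qInt]

theorem wienerPoly_zero_add_three (s t x : ℝ) (n : ℕ) :
    wienerPoly 0 s t x (n + 3) =
      X * wienerPoly 0 s t x (n + 2) - C t * wienerPoly 0 s t x (n + 1) := by
  simp only [wienerPoly]
  rw [poly]
  simp [qInt_zero_succ]

end QMeixner

/-! ### Existence: the Jacobi operator on ℓ² -/

open scoped InnerProductSpace in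
theorem exists_orthonormal_shift :
    ∃ (H : Type) (_ : NormedAddCommGroup H) (_ : InnerProductSpace ℂ H) (_ : CompleteSpace H)
      (e : ℕ → H) (R : H →L[ℂ] H),
      Orthonormal ℂ e ∧ (∀ n, R (e n) = e (n + 1)) ∧ (∀ n, star R (e (n + 1)) = e n) ∧
        star R (e 0) = 0 ∧ ‖R‖ ≤ 1 := by
  let e : ℕ → lp (fun _ : ℕ => ℂ) 2 := fun n => lp.single 2 n 1
  have he : Orthonormal ℂ e := by
    rw [orthonormal_iff_ite]
    intro i j
    simp only [e]
    rw [lp.inner_single_left]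
    by_cases h : i = j
    · subst h; simp
    · simp [h]
  have hV := (he.comp (fun n : ℕ => n + 1) (add_left_injective 1)).orthogonalFamily
  let R := hV.linearIsometry
  have hR : ∀ n, R (e n) = e (n + 1) := fun n => by
    simp only [R, e]
    rw [hV.linearIsometry_apply_single]
    simp [e]
  have hadj : ∀ v, star R.toContinuousLinearMap (R v) = v := fun v => by
    refine ext_inner_right ℂ fun w => ?_
    rw [ContinuousLinearMap.star_eq_adjoint, ContinuousLinearMap.adjoint_inner_left]
    exact R.inner_map_map v w
  refine ⟨_, _, _, inferInstance, e, R.toContinuousLinearMap, he, hR, fun n => ?_, ?_,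
    R.norm_toContinuousLinearMap_le⟩
  · rw [← hR n, hadj]
  · refine ext_inner_right ℂ fun w => ?_
    rw [ContinuousLinearMap.star_eq_adjoint, ContinuousLinearMap.adjoint_inner_left, inner_zero_left]
    -- The image of R is spanned by the vectors e (n + 1), all orthogonal to e 0.
    have h1 := (hV.hasSum_linearIsometry w).mapL (innerSL ℂ (e 0))
    refine h1.unique ?_
    convert hasSum_zero with n
    have h2 : ⟪e 0, e (n + 1)⟫_ℂ = 0 := he.2 (by simp)
    simp [h2]

open scoped InnerProductSpace in
-- The Jacobi matrix of the recurrence has diagonal x, 0, 0, … and off-diagonal √(t - s), √t, √t, ….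
-- It is a finite-rank perturbation of √t (R + R*), hence bounded. The constant 6 is not sharp.
theorem exists_jacobi_operator {s t : ℝ} (hs : 0 ≤ s) (x : ℝ) :
    ∃ (H : Type) (_ : NormedAddCommGroup H) (_ : InnerProductSpace ℂ H) (_ : CompleteSpace H)
      (e : ℕ → H) (J : H →L[ℂ] H),
      Orthonormal ℂ e ∧ IsSelfAdjoint J ∧ ‖J‖ ≤ |x| + 6 * √t ∧
      J (e 0) = (√(t - s)) • e 1 + x • e 0 ∧ J (e 1) = √t • e 2 + √(t - s) • e 0 ∧
      ∀ n, J (e (n + 2)) = √t • e (n + 3) + √t • e (n + 1) := by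
  obtain ⟨H, _, _, _, e, R, he, hR, hRa, hR0, hRn⟩ := exists_orthonormal_shift
  have hee : ∀ i j, ⟪e i, e j⟫_ℂ = if i = j then 1 else 0 := orthonormal_iff_ite.1 he
  let P : H →L[ℂ] H := InnerProductSpace.rankOne ℂ (e 0) (e 0)
  let S : H →L[ℂ] H := InnerProductSpace.rankOne ℂ (e 1) (e 0)
  have hPa : star P = P := by simp [P, ContinuousLinearMap.star_eq_adjoint]
  have hP : ‖P‖ = 1 := by simp [P, he.1]
  have hS : ‖S‖ = 1 := by simp [S, he.1]
  have hSa : star S = InnerProductSpace.rankOne ℂ (e 0) (e 1) := by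
    simp [S, ContinuousLinearMap.star_eq_adjoint]
  refine ⟨H, _, _, inferInstance, e,
    √t • (R + star R) + x • P + (√(t - s) - √t) • (S + star S), he, ?_, ?_, ?_, ?_, ?_⟩
  · have key : ∀ (c : ℝ) (T : H →L[ℂ] H),
        IsSelfAdjoint (c • (T + star T)) := fun c T => by
      refine IsSelfAdjoint.smul (by simp [IsSelfAdjoint]) ?_
      exact IsSelfAdjoint.add_star_self T
    refine ((key _ _).add (IsSelfAdjoint.smul (by simp [IsSelfAdjoint]) ?_)).add (key _ _)
    exact hPa
  · have hadj : ∀ T : H →L[ℂ] H, ‖star T‖ = ‖T‖ :=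
      fun T => LinearIsometryEquiv.norm_map _ T
    have h0 : √(t - s) ≤ √t := Real.sqrt_le_sqrt (by linarith)
    have h1 : ‖√t • (R + star R)‖ ≤ √t * 2 := by
      rw [norm_smul, Real.norm_of_nonneg (Real.sqrt_nonneg _)]
      gcongr
      refine (norm_add_le _ _).trans ?_
      rw [hadj]; linarith
    have h2 : ‖x • P‖ ≤ |x| := by rw [norm_smul, hP]; simp
    have h3 : ‖(√(t - s) - √t) • (S + star S)‖ ≤ √t * 2 := by
      rw [norm_smul]
      gcongr
      · rw [Real.norm_eq_abs, abs_le]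
        constructor <;> linarith [Real.sqrt_nonneg (t - s), Real.sqrt_nonneg t]
      · refine (norm_add_le _ _).trans ?_
        rw [hadj]; linarith
    have := norm_add₃_le (a := √t • (R + star R)) (b := x • P) (c := (√(t - s) - √t) • (S + star S))
    linarith [Real.sqrt_nonneg t]
  · simp only [add_apply, smul_apply, hR, hR0, hSa]
    simp only [P, S, InnerProductSpace.rankOne_apply, hee]
    simp
    module
  · simp only [add_apply, smul_apply, hR, hRa 0, hSa]
    simp only [P, S, InnerProductSpace.rankOne_apply, hee]
    simp
    module
  · intro n
    simp only [add_apply, smul_apply, hR, hRa (n + 1), hSa]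
    simp only [P, S, InnerProductSpace.rankOne_apply, hee]
    simp

namespace QMeixner

open scoped InnerProductSpace in
theorem exists_isOrthogonalityMeasure_wienerPoly {s t : ℝ} (hs : 0 ≤ s) (hst : s < t) (x : ℝ) :
    ∃ μ : Measure ℝ, IsOrthogonalityMeasure (wienerPoly 0 s t x) μ ∧
      ∀ᵐ y ∂μ, |y| ≤ |x| + 6 * √t := by
  obtain ⟨H, _, _, _, e, J, he, hJ, hJn, hJ0, hJ1, hJ2⟩ := exists_jacobi_operator (t := t) hs x
  obtain ⟨μ, hμ, hsupp, hint⟩ := exists_spectral_measure J hJ (e 0) (he.1 0)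
  have hsupp' : ∀ᵐ y ∂μ, |y| ≤ |x| + 6 * √t := hsupp.mono fun y hy => hy.trans hJn
  refine ⟨μ, ⟨hμ, fun p => ?_, ?_⟩, hsupp'⟩
  · obtain ⟨K, hK⟩ := (isCompact_Icc (a := -(|x| + 6 * √t)) (b := |x| + 6 * √t)
      ).exists_bound_of_continuousOn p.continuous.continuousOn
    exact Integrable.of_bound p.continuous.aestronglyMeasurable K
      (hsupp'.mono fun y hy => hK y (abs_le.1 hy))
  · have hst' : 0 ≤ t - s := by linarith
    have ht : 0 ≤ t := by linarith
    -- The scalar is the product of the off-diagonal entries passed on the way from e 0 to e (n +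
    -- 1).
    have hv : ∀ n, aeval J (wienerPoly 0 s t x (n + 1)) (e 0) = (√(t - s) * √t ^ n) • e (n + 1) := by
      intro n
      induction n using Nat.strong_induction_on with
      | _ n ih =>
        match n with
        | 0 => simp [wienerPoly_zero_one, hJ0, Algebra.algebraMap_eq_smul_one]
        | 1 =>
          have h0 := ih 0 (by simp)
          rw [wienerPoly_zero_one] at h0
          rw [wienerPoly_zero_two]
          simp only [map_sub, map_mul, aeval_X, sub_apply, aeval_C,
            mul_apply_eq_comp, Algebra.algebraMap_eq_smul_one, zero_add, pow_zero,
            smul_apply, one_apply_eq_self] at h0 ⊢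
          rw [← map_sub, h0]
          simp only [ContinuousLinearMap.map_smul_of_tower, hJ1, smul_add, smul_smul, mul_one,
            Real.mul_self_sqrt hst']
          module
        | n + 2 =>
          rw [wienerPoly_zero_add_three]
          simp only [map_sub, map_mul, aeval_X, sub_apply, aeval_C,
            mul_apply_eq_comp, Algebra.algebraMap_eq_smul_one,
            smul_apply, one_apply_eq_self]
          rw [ih (n + 1) (by omega), ih n (by omega)]
          simp only [ContinuousLinearMap.map_smul_of_tower, hJ2]
          have hsq : t = √t * √t := (Real.mul_self_sqrt ht).symm
          have h3 : t • (√(t - s) * √t ^ n) • e (n + 1) =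
              (√t * √t) • (√(t - s) * √t ^ n) • e (n + 1) := by rw [← hsq]
          rw [h3]
          module
    have hv' : ∀ n, ∃ c : ℝ, aeval J (wienerPoly 0 s t x n) (e 0) = c • e n := by
      rintro (_ | n)
      · exact ⟨1, by simp [wienerPoly_zero_zero]⟩
      · exact ⟨_, hv n⟩
    intro m n hmn
    simp_rw [← eval_mul]
    rw [hint, map_mul, mul_apply_eq_comp]
    have hsa : IsSelfAdjoint (aeval J (wienerPoly 0 s t x m)) := hJ.aeval_polynomial _
    -- Self-adjointness turns ⟨e₀, Q_m(J) Q_n(J) e₀⟩ into ⟨Q_m(J) e₀, Q_n(J) e₀⟩, an inner product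
    -- of multiples of e m and e n.
    rw [← ContinuousLinearMap.adjoint_inner_left, ← ContinuousLinearMap.star_eq_adjoint,
      hsa.star_eq]
    obtain ⟨c, hc⟩ := hv' m
    obtain ⟨d, hd⟩ := hv' n
    rw [hc, hd]
    have : ⟪e m, e n⟫_ℂ = 0 := he.2 hmn
    rw [inner_smul_left_eq_smul, inner_smul_right_eq_smul, this]
    simp

end QMeixner

/-! ### Uniqueness: determinacy of a compactly supported moment problem -/

theorem Polynomial.span_range_eq_top_of_X_mul_mem {Q : ℕ → ℝ[X]}
    (h1 : 1 ∈ Submodule.span ℝ (range Q)) (hX : ∀ n, X * Q n ∈ Submodule.span ℝ (range Q)) :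
    Submodule.span ℝ (range Q) = ⊤ := by
  have hmul : ∀ p ∈ Submodule.span ℝ (range Q), X * p ∈ Submodule.span ℝ (range Q) := by
    intro p hp
    induction hp using Submodule.span_induction with
    | mem p hp => obtain ⟨n, rfl⟩ := hp; exact hX n
    | zero => simp
    | add p q _ _ hp hq => rw [mul_add]; exact Submodule.add_mem _ hp hq
    | smul c p _ hp => rw [mul_smul_comm]; exact Submodule.smul_mem _ c hp
  have hpow : ∀ n : ℕ, (X : ℝ[X]) ^ n ∈ Submodule.span ℝ (range Q) := by
    intro n
    induction n with
    | zero => simpa using h1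
    | succ n ih => rw [pow_succ']; exact hmul _ ih
  refine eq_top_iff.2 fun p _ => ?_
  rw [p.as_sum_range_C_mul_X_pow]
  refine Submodule.sum_mem _ fun n _ => ?_
  rw [← smul_eq_C_mul]
  exact Submodule.smul_mem _ _ (hpow n)

namespace MeasureTheory

theorem abs_integral_le_of_forall_abs_le {μ : Measure ℝ} [IsProbabilityMeasure μ] {R ε : ℝ}
    (hμ : ∀ᵐ y ∂μ, |y| ≤ R) {F : ℝ → ℝ} (hF : ∀ y, |y| ≤ R → |F y| ≤ ε) :
    |∫ y, F y ∂μ| ≤ ε := by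
  have := norm_integral_le_of_norm_le_const (μ := μ) (f := F) (C := ε) (hμ.mono hF)
  simpa using this

theorem integrable_of_continuous_of_ae_abs_le {μ : Measure ℝ} [IsFiniteMeasure μ] {R : ℝ}
    (hμ : ∀ᵐ y ∂μ, |y| ≤ R) {F : ℝ → ℝ} (hF : Continuous F) : Integrable F μ := by
  obtain ⟨K, hK⟩ := (isCompact_Icc (a := -R) (b := R)).exists_bound_of_continuousOn hF.continuousOn
  exact Integrable.of_bound hF.aestronglyMeasurable K (hμ.mono fun y hy => hK y (abs_le.1 hy))

/-- Markov's inequality for (y / r) ^ (2k) bounds the ν-mass of |y| ≥ r by (R / r) ^ (2k), since the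
even moments are those of μ. Let k tend to infinity. -/
theorem ae_abs_lt_of_integral_eval_eq {μ ν : Measure ℝ} [IsProbabilityMeasure μ]
    [IsProbabilityMeasure ν] {R r : ℝ} (hR : 0 ≤ R) (hr : R < r) (hμ : ∀ᵐ y ∂μ, |y| ≤ R)
    (hν : ∀ p : ℝ[X], Integrable (fun y => p.eval y) ν)
    (h : ∀ p : ℝ[X], ∫ y, p.eval y ∂ν = ∫ y, p.eval y ∂μ) : ∀ᵐ y ∂ν, |y| < r := by
  have hr0 : 0 < r := hR.trans_lt hr
  have hbound : ∀ k : ℕ, ν.real {y | r ≤ |y|} ≤ ((R / r) ^ 2) ^ k := by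
    intro k
    let p : ℝ[X] := C ((r⁻¹ ^ 2) ^ k) * X ^ (2 * k)
    have hp : ∀ y, p.eval y = ((y / r) ^ 2) ^ k := fun y => by
      simp only [p, eval_mul, eval_C, eval_pow, eval_X]
      rw [pow_mul, ← mul_pow, ← mul_pow, div_eq_inv_mul]
    have h1 := mul_meas_ge_le_integral_of_nonneg (μ := ν) (f := fun y => p.eval y)
      (Eventually.of_forall fun y => by simp only [hp]; positivity) (hν p) 1
    rw [one_mul, h] at h1
    have h2 : |∫ y, p.eval y ∂μ| ≤ ((R / r) ^ 2) ^ k := by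
      refine abs_integral_le_of_forall_abs_le hμ fun y hy => ?_
      rw [hp, abs_of_nonneg (by positivity), ← sq_abs (y / r), abs_div, abs_of_pos hr0]
      gcongr
    refine le_trans (measureReal_mono fun y hy => ?_) (h1.trans ((le_abs_self _).trans h2))
    simp only [mem_ofPred_eq, hp] at hy ⊢
    refine one_le_pow₀ ?_
    rw [← sq_abs, abs_div, abs_of_pos hr0]
    exact one_le_pow₀ ((one_le_div hr0).2 hy)
  have hlt : (R / r) ^ 2 < 1 := by
    rw [sq_lt_one_iff_abs_lt_one, abs_of_nonneg (by positivity)]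
    exact (div_lt_one hr0).2 hr
  have h0 : ν.real {y | r ≤ |y|} ≤ 0 :=
    ge_of_tendsto' (tendsto_pow_atTop_nhds_zero_of_lt_one (by positivity) hlt) hbound
  have h1 : ν {y | r ≤ |y|} = 0 := by
    rw [← measureReal_eq_zero_iff]
    exact le_antisymm h0 measureReal_nonneg
  rw [ae_iff]
  simpa using h1

/-- Both measures live on one compact interval, where polynomials are uniformly dense in the
continuous functions. -/
theorem eq_of_integral_eval_eq {μ ν : Measure ℝ} [IsProbabilityMeasure μ] [IsProbabilityMeasure ν]
    {R : ℝ} (hR : 0 ≤ R) (hμ : ∀ᵐ y ∂μ, |y| ≤ R)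
    (hν : ∀ p : ℝ[X], Integrable (fun y => p.eval y) ν)
    (h : ∀ p : ℝ[X], ∫ y, p.eval y ∂ν = ∫ y, p.eval y ∂μ) : ν = μ := by
  have hν' : ∀ᵐ y ∂ν, |y| ≤ R + 1 :=
    (ae_abs_lt_of_integral_eval_eq hR (lt_add_one R) hμ hν h).mono fun y hy => hy.le
  have hμ' : ∀ᵐ y ∂μ, |y| ≤ R + 1 := hμ.mono fun y hy => by linarith
  refine ext_of_forall_integral_eq_of_IsFiniteMeasure fun f => ?_
  refine eq_of_forall_dist_le fun ε hε => ?_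
  rw [Real.dist_eq]
  obtain ⟨p, hp⟩ := exists_polynomial_near_of_continuousOn (-(R + 1)) (R + 1) f
    f.continuous.continuousOn (ε / 2) (half_pos hε)
  have h1 := abs_integral_le_of_forall_abs_le hν' (F := fun y => p.eval y - f y)
    fun y hy => (hp y (abs_le.1 hy)).le
  have h2 := abs_integral_le_of_forall_abs_le hμ' (F := fun y => p.eval y - f y)
    fun y hy => (hp y (abs_le.1 hy)).le
  rw [integral_sub (hν p) (f.integrable ν)] at h1
  rw [integral_sub (integrable_of_continuous_of_ae_abs_le hμ p.continuous) (f.integrable μ), ← h]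
    at h2
  rw [abs_le] at *
  constructor <;> linarith

end MeasureTheory

namespace QMeixner

theorem span_range_wienerPoly_zero (s t x : ℝ) :
    Submodule.span ℝ (range (wienerPoly 0 s t x)) = ⊤ := by
  have hQ : ∀ n, wienerPoly 0 s t x n ∈ Submodule.span ℝ (range (wienerPoly 0 s t x)) :=
    fun n => Submodule.subset_span ⟨n, rfl⟩
  have hc : ∀ (c : ℝ) n, C c * wienerPoly 0 s t x n ∈
      Submodule.span ℝ (range (wienerPoly 0 s t x)) := fun c n => by
    rw [← smul_eq_C_mul]; exact Submodule.smul_mem _ _ (hQ n)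
  refine span_range_eq_top_of_X_mul_mem (hQ 0) ?_
  rintro (_ | _ | n)
  · have : X * wienerPoly 0 s t x 0 = wienerPoly 0 s t x 1 + C x * wienerPoly 0 s t x 0 := by
      rw [wienerPoly_zero_zero, wienerPoly_zero_one]; ring
    rw [this]
    exact Submodule.add_mem _ (hQ _) (hc _ _)
  · have : X * wienerPoly 0 s t x 1 =
        wienerPoly 0 s t x 2 + C (t - s) * wienerPoly 0 s t x 0 := by
      rw [wienerPoly_zero_zero, wienerPoly_zero_one, wienerPoly_zero_two]; ring
    rw [zero_add, this]
    exact Submodule.add_mem _ (hQ _) (hc _ _)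
  · have : X * wienerPoly 0 s t x (n + 2) =
        wienerPoly 0 s t x (n + 3) + C t * wienerPoly 0 s t x (n + 1) := by
      rw [wienerPoly_zero_add_three]; ring
    rw [add_assoc, this]
    exact Submodule.add_mem _ (hQ _) (hc _ _)

theorem IsOrthogonalityMeasure.integral_wienerPoly_succ {s t x : ℝ} {μ : Measure ℝ}
    (hμ : IsOrthogonalityMeasure (wienerPoly 0 s t x) μ) (n : ℕ) :
    ∫ y, (wienerPoly 0 s t x (n + 1)).eval y ∂μ = 0 := by
  simpa [wienerPoly_zero_zero] using hμ.integral_mul_eq_zero 0 (n + 1) (by simp)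

/-- Orthogonality to Q_0 = 1 fixes the integral of every Q_n, and the Q_n span all polynomials. -/
theorem IsOrthogonalityMeasure.integral_eval_eq {s t x : ℝ} {μ ν : Measure ℝ}
    (hμ : IsOrthogonalityMeasure (wienerPoly 0 s t x) μ)
    (hν : IsOrthogonalityMeasure (wienerPoly 0 s t x) ν) (p : ℝ[X]) :
    ∫ y, p.eval y ∂ν = ∫ y, p.eval y ∂μ := by
  have := hμ.isProbabilityMeasure
  have := hν.isProbabilityMeasure
  have hp : p ∈ Submodule.span ℝ (range (wienerPoly 0 s t x)) := by
    rw [span_range_wienerPoly_zero]; trivial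
  induction hp using Submodule.span_induction with
  | mem p hp =>
    obtain ⟨_ | n, rfl⟩ := hp
    · simp [wienerPoly_zero_zero]
    · rw [hμ.integral_wienerPoly_succ, hν.integral_wienerPoly_succ]
  | zero => simp
  | add p q _ _ hp hq =>
    simp only [eval_add]
    rw [integral_add (hμ.integrable_eval p) (hμ.integrable_eval q),
      integral_add (hν.integrable_eval p) (hν.integrable_eval q), hp, hq]
  | smul c p _ hp =>
    simp only [eval_smul, smul_eq_mul]
    rw [integral_const_mul, integral_const_mul, hp]

theorem IsOrthogonalityMeasure.eq_of_ae_abs_le {s t x : ℝ} {μ ν : Measure ℝ} {R : ℝ} (hR : 0 ≤ R)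
    (hμ : IsOrthogonalityMeasure (wienerPoly 0 s t x) μ) (hμR : ∀ᵐ y ∂μ, |y| ≤ R)
    (hν : IsOrthogonalityMeasure (wienerPoly 0 s t x) ν) : ν = μ :=
  have := hμ.isProbabilityMeasure
  have := hν.isProbabilityMeasure
  eq_of_integral_eval_eq hR hμR hν.integrable_eval (hμ.integral_eval_eq hν)

theorem existsUnique_isOrthogonalityMeasure {s t : ℝ} (hs : 0 ≤ s) (hst : s < t) (x : ℝ) :
    ∃! μ : Measure ℝ, IsOrthogonalityMeasure (wienerPoly 0 s t x) μ := by
  obtain ⟨μ, hμ, hμR⟩ := exists_isOrthogonalityMeasure_wienerPoly hs hst x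
  exact ⟨μ, hμ, fun ν hν => hμ.eq_of_ae_abs_le (by positivity) hμR hν⟩

theorem isOrthogonalityMeasure_wienerTransition {s t : ℝ} (hs : 0 ≤ s) (hst : s < t) (x : ℝ) :
    IsOrthogonalityMeasure (wienerPoly 0 s t x) (wienerTransition 0 s t x) := by
  have h : ∃ μ, IsOrthogonalityMeasure (poly 0 0 0 s t x) μ :=
    (existsUnique_isOrthogonalityMeasure hs hst x).exists
  rw [wienerTransition, transition, dif_pos h]
  exact h.choose_spec

theorem ae_abs_le_wienerTransition {s t : ℝ} (hs : 0 ≤ s) (hst : s < t) (x : ℝ) :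
    ∀ᵐ y ∂(wienerTransition 0 s t x), |y| ≤ |x| + 6 * √t := by
  obtain ⟨μ, hμ, hμR⟩ := exists_isOrthogonalityMeasure_wienerPoly hs hst x
  rwa [hμ.eq_of_ae_abs_le (by positivity) hμR (isOrthogonalityMeasure_wienerTransition hs hst x)]

end QMeixner

/-! ### Semicircle polynomials and the weighted moments of the transition law -/

/-- The monic orthogonal polynomials of the semicircle law of variance `t`. -/
noncomputable def semicirclePoly (t : ℝ) : ℕ → ℝ[X]
  | 0 => 1
  | 1 => X
  | n + 2 => X * semicirclePoly t (n + 1) - C t * semicirclePoly t n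

theorem semicirclePoly_zero (t : ℝ) : semicirclePoly t 0 = 1 := rfl

theorem semicirclePoly_one (t : ℝ) : semicirclePoly t 1 = X := rfl

theorem semicirclePoly_add_two (t : ℝ) (n : ℕ) : semicirclePoly t (n + 2) =
    X * semicirclePoly t (n + 1) - C t * semicirclePoly t n := rfl

theorem span_range_semicirclePoly (t : ℝ) :
    Submodule.span ℝ (range (semicirclePoly t)) = ⊤ := by
  have hU : ∀ n, semicirclePoly t n ∈ Submodule.span ℝ (range (semicirclePoly t)) :=
    fun n => Submodule.subset_span ⟨n, rfl⟩
  refine span_range_eq_top_of_X_mul_mem (hU 0) ?_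
  rintro (_ | n)
  · rw [semicirclePoly_zero, mul_one]
    exact hU 1
  · have : X * semicirclePoly t (n + 1) =
        semicirclePoly t (n + 2) + t • semicirclePoly t n := by
      rw [semicirclePoly_add_two, smul_eq_C_mul]; ring
    rw [this]
    exact Submodule.add_mem _ (hU _) (Submodule.smul_mem _ _ (hU _))

theorem continuous_eval_semicirclePoly (n : ℕ) :
    Continuous fun z : ℝ × ℝ => (semicirclePoly z.1 n).eval z.2 := by
  induction n using Nat.strong_induction_on with
  | _ n ih =>
    match n with
    | 0 => simpa [semicirclePoly_zero] using continuous_const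
    | 1 => simpa [semicirclePoly_one] using continuous_snd
    | n + 2 =>
      have h0 := ih n (by omega)
      have h1 := ih (n + 1) (by omega)
      simp only [semicirclePoly_add_two, eval_sub, eval_mul, eval_X, eval_C]
      fun_prop

theorem eventually_abs_eval_semicirclePoly_sub_le (n : ℕ) (t R : ℝ) {ε : ℝ} (hε : 0 < ε) :
    ∀ᶠ τ in 𝓝 t, ∀ y, |y| ≤ R →
      |(semicirclePoly τ n).eval y - (semicirclePoly t n).eval y| ≤ ε := by
  obtain ⟨v, hv, h⟩ := (isCompact_Icc (a := -R) (b := R)).mem_uniformity_of_prod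
    (f := fun τ y => (semicirclePoly τ n).eval y)
    (continuous_eval_semicirclePoly n).continuousOn (mem_univ t) (Metric.dist_mem_uniformity hε)
  rw [nhdsWithin_univ] at hv
  filter_upwards [hv] with τ hτ y hy
  exact (h τ hτ y (abs_le.1 hy)).le

namespace QMeixner

/-- Both sides satisfy the same recurrence with constant coefficients and agree for the first two
indices. -/
theorem wienerPoly_zero_add_two (s t x : ℝ) (n : ℕ) : wienerPoly 0 s t x (n + 2) =
    (X - C x) * semicirclePoly t (n + 1) - C (t - s) * semicirclePoly t n := by
  induction n using Nat.strong_induction_on with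
  | _ n ih =>
    match n with
    | 0 => rw [wienerPoly_zero_two, semicirclePoly_zero, semicirclePoly_one]; ring
    | 1 =>
      rw [wienerPoly_zero_add_three, wienerPoly_zero_two, wienerPoly_zero_one]
      simp only [semicirclePoly]
      ring
    | n + 2 =>
      rw [wienerPoly_zero_add_three, ih (n + 1) (by omega), ih n (by omega)]
      rw [semicirclePoly_add_two t (n + 1), semicirclePoly_add_two t n]
      ring

namespace IsOrthogonalityMeasure

variable {s t x : ℝ} {μ : Measure ℝ}

theorem integral_sub (hμ : IsOrthogonalityMeasure (wienerPoly 0 s t x) μ) :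
    ∫ y, (y - x) ∂μ = 0 := by
  simpa [wienerPoly_zero_one] using hμ.integral_wienerPoly_succ 0

theorem integral_sub_sq (hμ : IsOrthogonalityMeasure (wienerPoly 0 s t x) μ) :
    ∫ y, (y - x) ^ 2 ∂μ = t - s := by
  have := hμ.isProbabilityMeasure
  have h : ∀ y, (y - x) ^ 2 = ((wienerPoly 0 s t x 2).eval y
      - x * (wienerPoly 0 s t x 1).eval y) + (t - s) := fun y => by
    simp [wienerPoly_zero_one, wienerPoly_zero_two]; ring
  simp_rw [h]
  have h1 := hμ.integrable_eval (wienerPoly 0 s t x 1)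
  have h2 := hμ.integrable_eval (wienerPoly 0 s t x 2)
  have h3 : Integrable (fun y => (wienerPoly 0 s t x 2).eval y
      - x * (wienerPoly 0 s t x 1).eval y) μ := h2.sub (h1.const_mul x)
  rw [integral_add h3 (integrable_const _), MeasureTheory.integral_sub h2 (h1.const_mul x),
    integral_const_mul, hμ.integral_wienerPoly_succ 0, hμ.integral_wienerPoly_succ 1]
  simp

theorem integral_sub_sq_mul_semicirclePoly_one
    (hμ : IsOrthogonalityMeasure (wienerPoly 0 s t x) μ) :
    ∫ y, (y - x) ^ 2 * (semicirclePoly t 1).eval y ∂μ = 0 := by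
  have h : ∀ y, (y - x) ^ 2 * (semicirclePoly t 1).eval y =
      (wienerPoly 0 s t x 1).eval y * (wienerPoly 0 s t x 2).eval y
        + (t - s) * (wienerPoly 0 s t x 1).eval y := fun y => by
    simp [wienerPoly_zero_one, wienerPoly_zero_two, semicirclePoly_one]; ring
  simp_rw [h]
  have h1 := hμ.integrable_eval (wienerPoly 0 s t x 1)
  have h2 := hμ.integrable_eval (wienerPoly 0 s t x 1 * wienerPoly 0 s t x 2)
  simp only [eval_mul] at h2
  rw [integral_add h2 (h1.const_mul _), integral_const_mul,
    hμ.integral_wienerPoly_succ 0, hμ.integral_mul_eq_zero 1 2 (by simp)]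
  simp

theorem integral_sub_sq_mul_semicirclePoly_add_two
    (hμ : IsOrthogonalityMeasure (wienerPoly 0 s t x) μ) (n : ℕ) :
    ∫ y, (y - x) ^ 2 * (semicirclePoly t (n + 2)).eval y ∂μ =
      (t - s) ^ 2 * ∫ y, (semicirclePoly t n).eval y ∂μ := by
  -- Applying `wienerPoly_zero_add_two` at n + 1 and at n makes the terms with U_{n+1} cancel.
  have h : ∀ y, (y - x) ^ 2 * (semicirclePoly t (n + 2)).eval y =
      ((wienerPoly 0 s t x 1).eval y * (wienerPoly 0 s t x (n + 3)).eval y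
        + (t - s) * (wienerPoly 0 s t x (n + 2)).eval y)
        + (t - s) ^ 2 * (semicirclePoly t n).eval y := fun y => by
    rw [wienerPoly_zero_add_two s t x (n + 1), wienerPoly_zero_add_two s t x n,
      wienerPoly_zero_one]
    simp only [eval_sub, eval_mul, eval_X, eval_C]
    ring
  simp_rw [h]
  have h1 := hμ.integrable_eval (wienerPoly 0 s t x (n + 2))
  have h2 := hμ.integrable_eval (wienerPoly 0 s t x 1 * wienerPoly 0 s t x (n + 3))
  have h3 := hμ.integrable_eval (semicirclePoly t n)
  simp only [eval_mul] at h2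
  have h4 : Integrable (fun y => (wienerPoly 0 s t x 1).eval y * (wienerPoly 0 s t x (n + 3)).eval y
      + (t - s) * (wienerPoly 0 s t x (n + 2)).eval y) μ := h2.add (h1.const_mul _)
  rw [integral_add h4 (h3.const_mul _), integral_add h2 (h1.const_mul _),
    integral_const_mul, integral_const_mul, hμ.integral_wienerPoly_succ (n + 1),
    hμ.integral_mul_eq_zero 1 (n + 3) (by simp)]
  simp

end IsOrthogonalityMeasure

end QMeixner

/-! ### Integrals against the semicircle law -/

/-- The density of the standard semicircle law on `(-2, 2)`. -/
noncomputable def semicircleDensity (y : ℝ) : ℝ := √(4 - y ^ 2) / (2 * Real.pi)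

theorem continuous_semicircleDensity : Continuous semicircleDensity := by
  unfold semicircleDensity; fun_prop

theorem semicircleDensity_nonneg (y : ℝ) : 0 ≤ semicircleDensity y := by
  unfold semicircleDensity; positivity

/-- These are rescaled Chebyshev polynomials of the second kind; multiplying by sin θ avoids
dividing by it. -/
theorem eval_semicirclePoly_mul_sin {t : ℝ} (ht : 0 ≤ t) (n : ℕ) (θ : ℝ) :
    (semicirclePoly t n).eval (√t * (2 * Real.cos θ)) * Real.sin θ =
      √t ^ n * Real.sin ((n + 1) * θ) := by
  induction n using Nat.strong_induction_on with
  | _ n ih =>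
    match n with
    | 0 => simp [semicirclePoly_zero]
    | 1 =>
      have : ((1 : ℕ) + 1 : ℝ) * θ = 2 * θ := by norm_num
      rw [this, Real.sin_two_mul, semicirclePoly_one, eval_X]; ring
    | n + 2 =>
      have h0 := ih n (by omega)
      have h1 := ih (n + 1) (by omega)
      have hsin : Real.sin ((((n + 2 : ℕ) : ℝ) + 1) * θ) =
          2 * Real.cos θ * Real.sin ((((n + 1 : ℕ) : ℝ) + 1) * θ) - Real.sin (((n : ℝ) + 1) * θ) := by
        have e1 : (((n + 2 : ℕ) : ℝ) + 1) * θ = (((n + 1 : ℕ) : ℝ) + 1) * θ + θ := by push_cast; ring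
        have e2 : ((n : ℝ) + 1) * θ = (((n + 1 : ℕ) : ℝ) + 1) * θ - θ := by push_cast; ring
        rw [e1, e2, Real.sin_add, Real.sin_sub]; ring
      have hsq : √t * √t = t := Real.mul_self_sqrt ht
      rw [semicirclePoly_add_two, eval_sub, eval_mul, eval_mul, eval_X, eval_C, hsin]
      linear_combination (√t * (2 * Real.cos θ)) * h1 - t * h0 +
        (√t ^ n * Real.sin ((n + 1) * θ)) * hsq

theorem integral_sin_mul_sin_succ (n : ℕ) :
    ∫ θ in (0 : ℝ)..Real.pi, Real.sin ((n + 1) * θ) * Real.sin θ =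
      if n = 0 then Real.pi / 2 else 0 := by
  rcases eq_or_ne n 0 with rfl | hn
  · simp [← sq, integral_sin_sq]
  · have hn' : (n : ℝ) ≠ 0 := by exact_mod_cast hn
    have hn2 : (n : ℝ) + 2 ≠ 0 := by positivity
    -- The primitive comes from 2 sin((n+1)θ) sin θ = cos(nθ) - cos((n+2)θ); its denominator n is
    -- why n = 0 is separate.
    have hd : ∀ θ ∈ uIcc 0 Real.pi, HasDerivAt
        (fun θ => (Real.sin (n * θ) / n - Real.sin ((n + 2) * θ) / (n + 2)) / 2)
        (Real.sin ((n + 1) * θ) * Real.sin θ) θ := fun θ _ => by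
      have h1 : HasDerivAt (fun θ : ℝ => Real.sin (n * θ)) (Real.cos (n * θ) * n) θ := by
        simpa using ((hasDerivAt_id θ).const_mul (n : ℝ)).sin
      have h2 : HasDerivAt (fun θ : ℝ => Real.sin ((n + 2) * θ))
          (Real.cos ((n + 2) * θ) * (n + 2)) θ := by
        simpa using ((hasDerivAt_id θ).const_mul ((n : ℝ) + 2)).sin
      refine (((h1.div_const (n : ℝ)).sub (h2.div_const ((n : ℝ) + 2))).div_const 2).congr_deriv ?_
      rw [mul_div_cancel_right₀ _ hn', mul_div_cancel_right₀ _ hn2]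
      have e1 : (n : ℝ) * θ = (n + 1) * θ - θ := by ring
      have e2 : ((n : ℝ) + 2) * θ = (n + 1) * θ + θ := by ring
      rw [e1, e2, Real.cos_add, Real.cos_sub]; ring
    rw [intervalIntegral.integral_eq_sub_of_hasDerivAt hd
      (Continuous.intervalIntegrable (by fun_prop) _ _), if_neg hn]
    have e3 : Real.sin (((n : ℝ) + 2) * Real.pi) = 0 := by
      have := Real.sin_nat_mul_pi (n + 2)
      push_cast at this
      exact this
    simp [e3, Real.sin_nat_mul_pi]

theorem integral_semicirclePoly_mul_semicircleDensity {t : ℝ} (ht : 0 ≤ t) (n : ℕ) :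
    ∫ y in Ioo (-2 : ℝ) 2, (semicirclePoly t n).eval (√t * y) * semicircleDensity y =
      if n = 0 then 1 else 0 := by
  rw [← integral_Ioc_eq_integral_Ioo, ← intervalIntegral.integral_of_le (by norm_num)]
  -- Substitution y = 2 cos θ, with θ running from π down to 0 as y increases.
  have hsub := intervalIntegral.integral_comp_mul_deriv (a := Real.pi) (b := 0)
    (f := fun θ => 2 * Real.cos θ) (f' := fun θ => -(2 * Real.sin θ))
    (g := fun y => (semicirclePoly t n).eval (√t * y) * semicircleDensity y)
    (fun θ _ => by simpa using (Real.hasDerivAt_cos θ).const_mul 2) (by fun_prop)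
    (by have := continuous_semicircleDensity; fun_prop)
  simp only [Real.cos_pi, Real.cos_zero, mul_neg, mul_one] at hsub
  rw [← hsub, intervalIntegral.integral_symm, ← intervalIntegral.integral_neg]
  have hcongr : ∫ θ in (0 : ℝ)..Real.pi, -(((fun y => (semicirclePoly t n).eval (√t * y) *
        semicircleDensity y) ∘ fun θ => 2 * Real.cos θ) θ * -(2 * Real.sin θ)) =
      ∫ θ in (0 : ℝ)..Real.pi, (2 / Real.pi * √t ^ n) *
        (Real.sin ((n + 1) * θ) * Real.sin θ) := by
    refine intervalIntegral.integral_congr fun θ hθ => ?_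
    rw [uIcc_of_le Real.pi_pos.le] at hθ
    have hs : 0 ≤ Real.sin θ := Real.sin_nonneg_of_mem_Icc hθ
    have h4 : 4 - (2 * Real.cos θ) ^ 2 = (2 * Real.sin θ) ^ 2 := by
      have := Real.sin_sq_add_cos_sq θ
      linear_combination (-4) * this
    simp only [Function.comp_apply, semicircleDensity]
    rw [h4, Real.sqrt_sq (by positivity)]
    have hU := eval_semicirclePoly_mul_sin ht n θ
    have hpi := Real.pi_ne_zero
    generalize (semicirclePoly t n).eval (√t * (2 * Real.cos θ)) = u at hU ⊢
    field_simp
    linear_combination Real.sin θ * hU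
  simp only [mul_neg] at hcongr ⊢
  rw [hcongr, intervalIntegral.integral_const_mul, integral_sin_mul_sin_succ]
  have hpi := Real.pi_ne_zero
  split_ifs with h
  · subst h; field_simp
  · simp

theorem integrableOn_mul_semicircleDensity (t : ℝ) {g : ℝ → ℝ} (hg : Continuous g) :
    IntegrableOn (fun y => g (√t * y) * semicircleDensity y) (Ioo (-2) 2) := by
  have := continuous_semicircleDensity
  have h : Continuous fun y => g (√t * y) * semicircleDensity y := by fun_prop
  exact (h.integrableOn_Icc).mono_set Ioo_subset_Icc_self

theorem abs_integral_mul_semicircleDensity_sub_le {t : ℝ} (ht : 0 ≤ t) {R ε : ℝ} (hR : 2 * √t ≤ R)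
    {F G : ℝ → ℝ} (hF : Continuous F) (hG : Continuous G) (hFG : ∀ y, |y| ≤ R → |F y - G y| ≤ ε) :
    |(∫ y in Ioo (-2 : ℝ) 2, F (√t * y) * semicircleDensity y) -
      ∫ y in Ioo (-2 : ℝ) 2, G (√t * y) * semicircleDensity y| ≤ ε := by
  rw [← integral_sub (integrableOn_mul_semicircleDensity t hF)
    (integrableOn_mul_semicircleDensity t hG), ← Real.norm_eq_abs]
  have h1 : ∫ y in Ioo (-2 : ℝ) 2, ε * semicircleDensity y = ε := by
    have := integral_semicirclePoly_mul_semicircleDensity ht 0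
    simp only [semicirclePoly_zero, eval_one, one_mul, if_true] at this
    rw [integral_const_mul, this, mul_one]
  refine (norm_integral_le_of_norm_le
    (integrableOn_mul_semicircleDensity t (continuous_const (y := ε))) ?_).trans h1.le
  refine (ae_restrict_iff' measurableSet_Ioo).2 (Eventually.of_forall fun y hy => ?_)
  rw [← sub_mul, norm_mul, Real.norm_of_nonneg (semicircleDensity_nonneg y)]
  refine mul_le_mul_of_nonneg_right (hFG _ ?_) (semicircleDensity_nonneg y)
  rw [abs_mul, abs_of_nonneg (Real.sqrt_nonneg t), mul_comm]
  exact (mul_le_mul_of_nonneg_right (abs_le.2 ⟨hy.1.le, hy.2.le⟩) (Real.sqrt_nonneg t)).trans hR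

/-! ### Convergence of the weighted transition laws to the semicircle law -/

theorem tendsto_of_tendsto_polynomial {ι : Type*} {l : Filter ι} {Ψ : ι → (ℝ → ℝ) → ℝ}
    {Ψ₀ : (ℝ → ℝ) → ℝ} {R : ℝ}
    (hΨ : ∀ᶠ i in l, ∀ (ε : ℝ) (F G : ℝ → ℝ), Continuous F → Continuous G →
      (∀ y, |y| ≤ R → |F y - G y| ≤ ε) → |Ψ i F - Ψ i G| ≤ ε)
    (hΨ₀ : ∀ (ε : ℝ) (F G : ℝ → ℝ), Continuous F → Continuous G →
      (∀ y, |y| ≤ R → |F y - G y| ≤ ε) → |Ψ₀ F - Ψ₀ G| ≤ ε)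
    (hp : ∀ p : ℝ[X], Tendsto (fun i => Ψ i fun y => p.eval y) l (𝓝 (Ψ₀ fun y => p.eval y)))
    {g : ℝ → ℝ} (hg : Continuous g) : Tendsto (fun i => Ψ i g) l (𝓝 (Ψ₀ g)) := by
  rw [Metric.tendsto_nhds]
  intro ε hε
  obtain ⟨p, hpg⟩ := exists_polynomial_near_of_continuousOn (-R) R g hg.continuousOn (ε / 4)
    (by positivity)
  have hpg' : ∀ y, |y| ≤ R → |p.eval y - g y| ≤ ε / 4 := fun y hy => (hpg y (abs_le.1 hy)).le
  filter_upwards [hΨ, Metric.tendsto_nhds.1 (hp p) (ε / 4) (by positivity)] with i hi hpi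
  have h1 := hi _ _ _ p.continuous hg hpg'
  have h2 := hΨ₀ _ _ _ p.continuous hg hpg'
  rw [Real.dist_eq] at *
  rw [abs_le] at h1 h2
  rw [abs_lt] at *
  constructor <;> linarith

namespace QMeixner

namespace IsOrthogonalityMeasure

variable {s t x : ℝ} {μ : Measure ℝ}

theorem integrable_sub_sq_mul (hμ : IsOrthogonalityMeasure (wienerPoly 0 s t x) μ) {R : ℝ}
    (hR : ∀ᵐ y ∂μ, |y| ≤ R) {g : ℝ → ℝ} (hg : Continuous g) :
    Integrable (fun y => (y - x) ^ 2 * g y) μ :=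
  have := hμ.isProbabilityMeasure
  integrable_of_continuous_of_ae_abs_le hR (by fun_prop)

/-- The variance of μ is t - s, so (y - x)² / (t - s) is a probability density with respect to μ. -/
theorem abs_inv_mul_integral_sub_sq_mul_sub_le
    (hμ : IsOrthogonalityMeasure (wienerPoly 0 s t x) μ) (hst : s < t) {R ε : ℝ}
    (hR : ∀ᵐ y ∂μ, |y| ≤ R) {F G : ℝ → ℝ} (hF : Continuous F) (hG : Continuous G)
    (hFG : ∀ y, |y| ≤ R → |F y - G y| ≤ ε) :
    |(t - s)⁻¹ * (∫ y, (y - x) ^ 2 * F y ∂μ) - (t - s)⁻¹ * ∫ y, (y - x) ^ 2 * G y ∂μ| ≤ ε := by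
  have hpos : 0 < t - s := sub_pos.2 hst
  have h1 : |∫ y, ((y - x) ^ 2 * F y - (y - x) ^ 2 * G y) ∂μ| ≤ ∫ y, ε * (y - x) ^ 2 ∂μ := by
    rw [← Real.norm_eq_abs]
    refine norm_integral_le_of_norm_le ?_ (hR.mono fun y hy => ?_)
    · have := (hμ.integrable_sub_sq_mul hR (continuous_const (y := ε)))
      simpa only [mul_comm] using this
    · rw [← mul_sub, norm_mul, Real.norm_of_nonneg (sq_nonneg _), mul_comm]
      exact mul_le_mul_of_nonneg_right (hFG y hy) (sq_nonneg _)
  rw [MeasureTheory.integral_sub (hμ.integrable_sub_sq_mul hR hF) (hμ.integrable_sub_sq_mul hR hG),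
    integral_const_mul, hμ.integral_sub_sq] at h1
  rw [← mul_sub, abs_mul, abs_of_pos (inv_pos.2 hpos), inv_mul_le_iff₀ hpos, mul_comm (t - s)]
  exact h1

end IsOrthogonalityMeasure

/-- Letting both times move covers the left generator (s = t₀ - h, t fixed) and the right one (s
fixed, t = t₀ + h) at once. -/
theorem tendsto_inv_mul_integral_sub_sq_mul {l : Filter ℝ} {s t : ℝ → ℝ} {t₀ : ℝ} (ht₀ : 0 ≤ t₀)
    (hs : ∀ᶠ h in l, 0 ≤ s h) (hst : ∀ᶠ h in l, s h < t h) (ht : Tendsto t l (𝓝 t₀))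
    (hsub : Tendsto (fun h => t h - s h) l (𝓝 0)) (x : ℝ) {g : ℝ → ℝ} (hg : Continuous g) :
    Tendsto (fun h => (t h - s h)⁻¹ *
        ∫ y, (y - x) ^ 2 * g y ∂(wienerTransition 0 (s h) (t h) x)) l
      (𝓝 (∫ y in Ioo (-2 : ℝ) 2, g (√t₀ * y) * semicircleDensity y)) := by
  set R := |x| + 6 * √(t₀ + 1) with hRdef
  have hR0 : 2 * √t₀ ≤ R := by
    have : √t₀ ≤ √(t₀ + 1) := Real.sqrt_le_sqrt (by linarith)
    have := abs_nonneg x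
    have := Real.sqrt_nonneg (t₀ + 1)
    linarith
  have hsupp : ∀ᶠ h in l, ∀ᵐ y ∂(wienerTransition 0 (s h) (t h) x), |y| ≤ R := by
    filter_upwards [hs, hst, ht.eventually (gt_mem_nhds (lt_add_one t₀))] with h h0 h1 h2
    refine (ae_abs_le_wienerTransition h0 h1 x).mono fun y hy => hy.trans ?_
    have : √(t h) ≤ √(t₀ + 1) := Real.sqrt_le_sqrt h2.le
    linarith
  have hcontr : ∀ᶠ h in l, ∀ (ε : ℝ) (F G : ℝ → ℝ), Continuous F → Continuous G →
      (∀ y, |y| ≤ R → |F y - G y| ≤ ε) →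
      |(t h - s h)⁻¹ * (∫ y, (y - x) ^ 2 * F y ∂(wienerTransition 0 (s h) (t h) x)) -
        (t h - s h)⁻¹ * ∫ y, (y - x) ^ 2 * G y ∂(wienerTransition 0 (s h) (t h) x)| ≤ ε := by
    filter_upwards [hs, hst, hsupp] with h h0 h1 h2 ε F G hF hG hFG
    exact (isOrthogonalityMeasure_wienerTransition h0 h1 x).abs_inv_mul_integral_sub_sq_mul_sub_le
      h1 h2 hF hG hFG
  refine tendsto_of_tendsto_polynomial
    (Ψ := fun h g => (t h - s h)⁻¹ * ∫ y, (y - x) ^ 2 * g y ∂(wienerTransition 0 (s h) (t h) x))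
    (Ψ₀ := fun g => ∫ y in Ioo (-2 : ℝ) 2, g (√t₀ * y) * semicircleDensity y) hcontr
    (fun ε F G hF hG => abs_integral_mul_semicircleDensity_sub_le ht₀ hR0 hF hG) (fun p => ?_) hg
  have hp : p ∈ Submodule.span ℝ (range (semicirclePoly t₀)) := by
    rw [span_range_semicirclePoly]; trivial
  induction hp using Submodule.span_induction with
  | mem p hp =>
    obtain ⟨n, rfl⟩ := hp
    -- The moment identities hold for the semicircle polynomials of parameter t h, not t₀. The limit
    -- is therefore taken along these moving polynomials, which are uniformly close on [-R, R] to
    -- those of parameter t₀.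
    have hmoving : Tendsto (fun h => (t h - s h)⁻¹ * ∫ y, (y - x) ^ 2 *
        (semicirclePoly (t h) n).eval y ∂(wienerTransition 0 (s h) (t h) x)) l
        (𝓝 (if n = 0 then 1 else 0)) := by
      rcases n with _ | _ | n
      · refine tendsto_const_nhds.congr' ?_
        filter_upwards [hs, hst] with h h0 h1
        have hQ := isOrthogonalityMeasure_wienerTransition h0 h1 x
        simp only [semicirclePoly_zero, eval_one, mul_one, hQ.integral_sub_sq, if_true]
        rw [inv_mul_cancel₀ (sub_pos.2 h1).ne']
      · refine tendsto_const_nhds.congr' ?_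
        filter_upwards [hs, hst] with h h0 h1
        have hQ := isOrthogonalityMeasure_wienerTransition h0 h1 x
        rw [zero_add, hQ.integral_sub_sq_mul_semicirclePoly_one]
        simp
      · rw [if_neg (by simp)]
        obtain ⟨K, hK⟩ := (isCompact_Icc (a := -R) (b := R)).exists_bound_of_continuousOn
          (semicirclePoly t₀ n).continuous.continuousOn
        -- K bounds U_n for parameter t₀ on [-R, R]; the extra 1 absorbs the change of parameter.
        have hlim : Tendsto (fun h => (t h - s h) * (K + 1)) l (𝓝 0) := by
          simpa using hsub.mul_const (K + 1)
        refine squeeze_zero_norm' ?_ hlim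
        filter_upwards [hs, hst, hsupp,
          ht.eventually (eventually_abs_eval_semicirclePoly_sub_le n t₀ R one_pos)] with h h0 h1 h2 h3
        have hQ := isOrthogonalityMeasure_wienerTransition h0 h1 x
        have := hQ.isProbabilityMeasure
        have hpos := sub_pos.2 h1
        rw [hQ.integral_sub_sq_mul_semicirclePoly_add_two, sq, mul_assoc,
          inv_mul_cancel_left₀ hpos.ne', norm_mul, Real.norm_of_nonneg hpos.le]
        refine mul_le_mul_of_nonneg_left ?_ hpos.le
        refine abs_integral_le_of_forall_abs_le h2 fun y hy => ?_
        have h4 := hK y (abs_le.1 hy)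
        have h5 := h3 y hy
        rw [Real.norm_eq_abs] at h4
        rw [abs_le] at *
        constructor <;> linarith
    simp only
    rw [integral_semicirclePoly_mul_semicircleDensity ht₀ n]
    rw [Metric.tendsto_nhds] at hmoving ⊢
    intro ε hε
    filter_upwards [hmoving (ε / 2) (half_pos hε), hcontr,
      ht.eventually (eventually_abs_eval_semicirclePoly_sub_le n t₀ R (half_pos hε))] with h h1 h2 h3
    have h4 := h2 _ _ _ (semicirclePoly (t h) n).continuous (semicirclePoly t₀ n).continuous h3
    rw [Real.dist_eq] at *
    rw [abs_le] at h4
    rw [abs_lt] at *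
    constructor <;> linarith
  | zero => simpa using tendsto_const_nhds
  | add p q _ _ hp hq =>
    simp only [eval_add, add_mul, mul_add]
    rw [integral_add (integrableOn_mul_semicircleDensity t₀ p.continuous)
      (integrableOn_mul_semicircleDensity t₀ q.continuous)]
    refine (hp.add hq).congr' ?_
    filter_upwards [hs, hst, hsupp] with h h0 h1 h2
    have hQ := isOrthogonalityMeasure_wienerTransition h0 h1 x
    rw [integral_add (hQ.integrable_sub_sq_mul h2 p.continuous)
      (hQ.integrable_sub_sq_mul h2 q.continuous), mul_add]
  | smul c p _ hp =>
    simp only [eval_smul, smul_eq_mul, mul_assoc, mul_left_comm _ c, integral_const_mul] at hp ⊢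
    exact hp.const_mul c

end QMeixner

/-! ### Second-order Taylor quotient and the generators -/

/-- The quotient `(f y - f x - f' x * (y - x)) / (y - x) ^ 2`, in the integral form which also
makes sense for `y = x`. -/
noncomputable def secondTaylorQuotient (f : ℝ → ℝ) (x y : ℝ) : ℝ :=
  ∫ u in (0 : ℝ)..1, (1 - u) * iteratedDeriv 2 f (x + u * (y - x))

theorem ContDiff.hasDerivAt_deriv_iteratedDeriv_two {f : ℝ → ℝ} (hf : ContDiff ℝ 2 f) (z : ℝ) :
    HasDerivAt (deriv f) (iteratedDeriv 2 f z) z := by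
  have h1 : ContDiff ℝ 1 (deriv f) := hf.deriv'
  rw [iteratedDeriv_succ, iteratedDeriv_one]
  exact (h1.differentiable one_ne_zero z).hasDerivAt

theorem ContDiff.eq_add_sq_mul_secondTaylorQuotient {f : ℝ → ℝ} (hf : ContDiff ℝ 2 f) (x y : ℝ) :
    f y = f x + deriv f x * (y - x) + (y - x) ^ 2 * secondTaylorQuotient f x y := by
  have hc : Continuous (iteratedDeriv 2 f) := hf.continuous_iteratedDeriv 2 le_rfl
  -- Integration by parts, written as an explicit primitive in u.
  have hd : ∀ u ∈ uIcc (0 : ℝ) 1, HasDerivAt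
      (fun u => (1 - u) * (deriv f (x + u * (y - x)) * (y - x)) + f (x + u * (y - x)))
      ((y - x) ^ 2 * ((1 - u) * iteratedDeriv 2 f (x + u * (y - x)))) u := fun u _ => by
    have hl : HasDerivAt (fun u => x + u * (y - x)) (y - x) u := by
      simpa using ((hasDerivAt_id u).mul_const (y - x)).const_add x
    have h1 := (hf.hasDerivAt_deriv_iteratedDeriv_two (x + u * (y - x))).comp u hl
    have h2 := (hf.differentiable two_ne_zero (x + u * (y - x))).hasDerivAt.comp u hl
    have h3 := (((hasDerivAt_id u).const_sub 1).mul (h1.mul_const (y - x))).add h2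
    refine h3.congr_deriv ?_
    simp only [Function.comp_apply, id]
    ring
  have h := intervalIntegral.integral_eq_sub_of_hasDerivAt hd
    (Continuous.intervalIntegrable (by fun_prop) _ _)
  rw [intervalIntegral.integral_const_mul] at h
  rw [secondTaylorQuotient, h]
  simp
  ring

theorem ContDiff.continuous_secondTaylorQuotient {f : ℝ → ℝ} (hf : ContDiff ℝ 2 f) (x : ℝ) :
    Continuous (secondTaylorQuotient f x) := by
  have hc : Continuous (iteratedDeriv 2 f) := hf.continuous_iteratedDeriv 2 le_rfl
  exact intervalIntegral.continuous_parametric_intervalIntegral_of_continuous'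
    (by fun_prop) 0 1

theorem abs_secondTaylorQuotient_le {f : ℝ → ℝ} {K : ℝ} (hK : ∀ z, |iteratedDeriv 2 f z| ≤ K)
    (x y : ℝ) : |secondTaylorQuotient f x y| ≤ K := by
  have := intervalIntegral.norm_integral_le_of_norm_le_const (a := 0) (b := 1) (C := K)
    (f := fun u => (1 - u) * iteratedDeriv 2 f (x + u * (y - x))) fun u hu => by
      rw [uIoc_of_le zero_le_one] at hu
      rw [norm_mul, Real.norm_of_nonneg (by linarith [hu.2] : 0 ≤ 1 - u)]
      refine (mul_le_of_le_one_left (norm_nonneg _) (by linarith [hu.1])).trans (hK _)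
  simpa [secondTaylorQuotient] using this

namespace QMeixner

theorem freeIntegrand_eq {f : ℝ → ℝ} (hf : ContDiff ℝ 2 f) {t x y : ℝ} (hxy : √t * y ≠ x) :
    freeIntegrand t f x y = secondTaylorQuotient f x (√t * y) * semicircleDensity y := by
  have hne : √t * y - x ≠ 0 := sub_ne_zero.2 hxy
  have h1 := (hf.differentiable two_ne_zero x).hasDerivAt
  have h2 := ((h1.const_sub (f (√t * y))).div ((hasDerivAt_id x).const_sub (√t * y)) hne).deriv
  have h3 := hf.eq_add_sq_mul_secondTaylorQuotient x (√t * y)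
  rw [freeIntegrand, semicircleDensity]
  congr 1
  refine h2.trans ?_
  simp only [id]
  rw [div_eq_iff (pow_ne_zero 2 hne)]
  linear_combination h3

/-- Only y = x / √t is exceptional: there the differentiated quotient has a vanishing denominator at
x. -/
theorem freeIntegrand_ae_eq {f : ℝ → ℝ} (hf : ContDiff ℝ 2 f) {t : ℝ} (ht : 0 < t) (x : ℝ) :
    freeIntegrand t f x =ᵐ[volume.restrict (Ioo (-2) 2)]
      fun y => secondTaylorQuotient f x (√t * y) * semicircleDensity y := by
  refine ae_restrict_of_ae ?_
  filter_upwards [compl_mem_ae_iff.2 (measure_singleton (x / √t))] with y hy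
  refine freeIntegrand_eq hf fun h => hy ?_
  rw [mem_singleton_iff, eq_div_iff (Real.sqrt_pos.2 ht).ne', mul_comm]
  exact h

theorem integrableOn_freeIntegrand {f : ℝ → ℝ} (hf : ContDiff ℝ 2 f) {t : ℝ} (ht : 0 < t) (x : ℝ) :
    IntegrableOn (freeIntegrand t f x) (Ioo (-2) 2) :=
  (integrableOn_mul_semicircleDensity t (hf.continuous_secondTaylorQuotient x)).congr
    (freeIntegrand_ae_eq hf ht x).symm

theorem integral_wienerTransition_sub_eq {f : ℝ → ℝ} (hf : ContDiff ℝ 2 f) {s t : ℝ}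
    (hs : 0 ≤ s) (hst : s < t) (x : ℝ) :
    (∫ y, f y ∂(wienerTransition 0 s t x)) - f x =
      ∫ y, (y - x) ^ 2 * secondTaylorQuotient f x y ∂(wienerTransition 0 s t x) := by
  have hQ := isOrthogonalityMeasure_wienerTransition hs hst x
  have hR := ae_abs_le_wienerTransition hs hst x
  have := hQ.isProbabilityMeasure
  have hi := hQ.integrable_sub_sq_mul hR (hf.continuous_secondTaylorQuotient x)
  have hl : Integrable (fun y => deriv f x * (y - x)) (wienerTransition 0 s t x) :=
    integrable_of_continuous_of_ae_abs_le hR (by fun_prop)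
  have hl' : Integrable (fun y => f x + deriv f x * (y - x)) (wienerTransition 0 s t x) :=
    (integrable_const _).add hl
  have h : ∫ y, f y ∂(wienerTransition 0 s t x) = ∫ y, ((f x + deriv f x * (y - x)) +
      (y - x) ^ 2 * secondTaylorQuotient f x y) ∂(wienerTransition 0 s t x) :=
    integral_congr_ae (Eventually.of_forall (hf.eq_add_sq_mul_secondTaylorQuotient x))
  rw [h, integral_add hl' hi, integral_add (integrable_const _) hl, integral_const_mul,
    hQ.integral_sub]
  simp

theorem abs_inv_mul_integral_wienerTransition_sub_le {f : ℝ → ℝ} (hf : ContDiff ℝ 2 f) {K : ℝ}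
    (hK : ∀ z, |iteratedDeriv 2 f z| ≤ K) {s t : ℝ} (hs : 0 ≤ s) (hst : s < t) (x : ℝ) :
    |(t - s)⁻¹ * ((∫ y, f y ∂(wienerTransition 0 s t x)) - f x)| ≤ K := by
  rw [integral_wienerTransition_sub_eq hf hs hst]
  -- The contraction estimate is used with the zero function as second argument and K as ε.
  simpa using (isOrthogonalityMeasure_wienerTransition hs hst
    x).abs_inv_mul_integral_sub_sq_mul_sub_le hst (ae_abs_le_wienerTransition hs hst x)
    (hf.continuous_secondTaylorQuotient x) (continuous_const (y := (0 : ℝ)))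
    fun y _ => by simpa using abs_secondTaylorQuotient_le hK x y

theorem tendsto_inv_mul_integral_wienerTransition_sub {f : ℝ → ℝ} (hf : ContDiff ℝ 2 f)
    {l : Filter ℝ} {s t : ℝ → ℝ} {t₀ : ℝ} (ht₀ : 0 < t₀)
    (hs : ∀ᶠ h in l, 0 ≤ s h) (hst : ∀ᶠ h in l, s h < t h) (ht : Tendsto t l (𝓝 t₀))
    (hsub : Tendsto (fun h => t h - s h) l (𝓝 0)) (x : ℝ) :
    Tendsto (fun h => (t h - s h)⁻¹ *
        ((∫ y, f y ∂(wienerTransition 0 (s h) (t h) x)) - f x)) l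
      (𝓝 (∫ y in Ioo (-2 : ℝ) 2, freeIntegrand t₀ f x y)) := by
  rw [integral_congr_ae (freeIntegrand_ae_eq hf ht₀ x)]
  refine (tendsto_inv_mul_integral_sub_sq_mul ht₀.le hs hst ht hsub x
    (hf.continuous_secondTaylorQuotient x)).congr' ?_
  filter_upwards [hs, hst] with h h0 h1
  rw [integral_wienerTransition_sub_eq hf h0 h1]

theorem tendsto_leftQuotient_wienerTransition {f : ℝ → ℝ} (hf : ContDiff ℝ 2 f) {t : ℝ}
    (ht : 0 < t) (x : ℝ) :
    Tendsto (fun h => leftQuotient (wienerTransition 0) t f h x) (𝓝[>] 0)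
      (𝓝 (∫ y in Ioo (-2 : ℝ) 2, freeIntegrand t f x y)) := by
  have hid : Tendsto (fun h : ℝ => h) (𝓝[>] 0) (𝓝 0) := nhdsWithin_le_nhds
  have := tendsto_inv_mul_integral_wienerTransition_sub hf (l := 𝓝[>] (0 : ℝ)) (s := fun h => t - h)
    (t := fun _ => t) ht ((hid.eventually (gt_mem_nhds ht)).mono fun h hh => (sub_pos.2 hh).le)
    (eventually_mem_nhdsWithin.mono fun h hh => sub_lt_self t hh) tendsto_const_nhds
    (by simpa using hid) x
  simpa only [leftQuotient, sub_sub_cancel] using this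

theorem tendsto_rightQuotient_wienerTransition {f : ℝ → ℝ} (hf : ContDiff ℝ 2 f) {t : ℝ}
    (ht : 0 < t) (x : ℝ) :
    Tendsto (fun h => rightQuotient (wienerTransition 0) t f h x) (𝓝[>] 0)
      (𝓝 (∫ y in Ioo (-2 : ℝ) 2, freeIntegrand t f x y)) := by
  have hid : Tendsto (fun h : ℝ => h) (𝓝[>] 0) (𝓝 0) := nhdsWithin_le_nhds
  have := tendsto_inv_mul_integral_wienerTransition_sub hf (l := 𝓝[>] (0 : ℝ)) (s := fun _ => t)
    (t := fun h => t + h) ht (Eventually.of_forall fun _ => ht.le)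
    (eventually_mem_nhdsWithin.mono fun h hh => lt_add_of_pos_right t hh)
    (by simpa using hid.const_add t) (by simpa using hid) x
  simpa only [rightQuotient, add_sub_cancel_left] using this

end QMeixner

/-! ### Polynomial test functions -/

/-- The Taylor remainder of order two of a polynomial, divided by `(y - x) ^ 2`, is a polynomial
in `x` and `y`. -/
theorem Polynomial.exists_eval_sub_eq_sq_mul (f : ℝ[X]) : ∃ G : ℝ[X][X], ∀ x y : ℝ,
    f.eval y = f.eval x + f.derivative.eval x * (y - x) + (y - x) ^ 2 * G.evalEval x y := by
  induction f using Polynomial.induction_on' with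
  | add p q hp hq =>
    obtain ⟨G, hG⟩ := hp
    obtain ⟨G', hG'⟩ := hq
    refine ⟨G + G', fun x y => ?_⟩
    simp only [eval_add, derivative_add, evalEval_add]
    linear_combination hG x y + hG' x y
  | monomial n c =>
    induction n with
    | zero => exact ⟨0, fun x y => by simp⟩
    | succ n ih =>
      obtain ⟨G, hG⟩ := ih
      -- Multiply the expansion of p by y = x + (y - x): the term p'(x)(y - x) contributes an extra
      -- p'(x)(y - x)². The outer variable `X` is y, and the coefficients are polynomials in x.
      refine ⟨X * G + C (derivative (monomial n c)), fun x y => ?_⟩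
      rw [← monomial_mul_X]
      simp only [derivative_mul, derivative_X, eval_add, eval_mul, eval_X, mul_one,
        evalEval_add, evalEval_mul, evalEval_X, evalEval_C]
      linear_combination y * hG x y

/-- Integrating out y replaces each of its powers by a moment and leaves a polynomial in x. -/
theorem exists_eval_eq_integral_evalEval_mul_semicircleDensity (t : ℝ) (G : ℝ[X][X]) :
    ∃ g : ℝ[X], ∀ x : ℝ,
      g.eval x = ∫ y in Ioo (-2 : ℝ) 2, G.evalEval x (√t * y) * semicircleDensity y := by
  have hcont : ∀ (x : ℝ) (G : ℝ[X][X]), Continuous fun y => G.evalEval x y := fun x G => by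
    simp only [← map_evalRingHom_eval]
    exact Polynomial.continuous _
  induction G using Polynomial.induction_on' with
  | add p q hp hq =>
    obtain ⟨g, hg⟩ := hp
    obtain ⟨g', hg'⟩ := hq
    refine ⟨g + g', fun x => ?_⟩
    simp only [evalEval_add, add_mul]
    rw [eval_add, hg, hg', integral_add (integrableOn_mul_semicircleDensity t (hcont x p))
      (integrableOn_mul_semicircleDensity t (hcont x q))]
  | monomial n c =>
    refine ⟨c * C (∫ y in Ioo (-2 : ℝ) 2, (√t * y) ^ n * semicircleDensity y), fun x => ?_⟩
    rw [eval_mul, eval_C, ← integral_const_mul]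
    simp only [evalEval, eval_monomial, eval_mul, eval_pow, eval_C, mul_assoc]

namespace QMeixner

theorem exists_eval_eq_integral_freeIntegrand {t : ℝ} (ht : 0 < t) (f : ℝ[X]) :
    ∃ g : ℝ[X], ∀ x : ℝ,
      g.eval x = ∫ y in Ioo (-2 : ℝ) 2, freeIntegrand t (fun y => f.eval y) x y := by
  obtain ⟨G, hG⟩ := f.exists_eval_sub_eq_sq_mul
  obtain ⟨g, hg⟩ := exists_eval_eq_integral_evalEval_mul_semicircleDensity t G
  have hf : ContDiff ℝ 2 fun y => f.eval y := by
    simpa using f.contDiff_aeval (𝕜 := ℝ) 2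
  refine ⟨g, fun x => (hg x).trans (integral_congr_ae ?_)⟩
  filter_upwards [freeIntegrand_ae_eq hf ht x,
    ae_restrict_of_ae (compl_mem_ae_iff.2 (measure_singleton (x / √t)))] with y hy hxy
  rw [hy]
  congr 1
  have hne : √t * y - x ≠ 0 := fun h => hxy <| by
    rw [mem_singleton_iff, eq_div_iff (Real.sqrt_pos.2 ht).ne', mul_comm]
    exact sub_eq_zero.1 h
  have h1 := hf.eq_add_sq_mul_secondTaylorQuotient x (√t * y)
  have h2 := hG x (√t * y)
  rw [Polynomial.deriv] at h1
  -- Off y = x / √t the two Taylor remainders agree and (√t y - x)² cancels.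
  refine mul_left_cancel₀ (pow_ne_zero 2 hne) ?_
  linear_combination h1 - h2

end QMeixner

theorem mainTheorem4 :
    -- the transition probabilities are well defined
    (∀ s t x : ℝ, 0 ≤ s → s < t →
      ∃! μ : Measure ℝ, QMeixner.IsOrthogonalityMeasure (QMeixner.wienerPoly 0 s t x) μ) ∧
    -- both generators on bounded continuous functions with bounded continuous second derivative
    (∀ t : ℝ, 0 < t → ∀ f : ℝ →ᵇ ℝ, ContDiff ℝ 2 (f : ℝ → ℝ) →
      (∃ K : ℝ, ∀ x : ℝ, |iteratedDeriv 2 (f : ℝ → ℝ) x| ≤ K) →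
        (∀ x : ℝ, IntegrableOn (QMeixner.freeIntegrand t f x) (Ioo (-2) 2)) ∧
        QMeixner.HasWeakLeftGenerator (QMeixner.wienerTransition 0) t f
          (fun x => ∫ y in Ioo (-2 : ℝ) 2, QMeixner.freeIntegrand t f x y) ∧
        QMeixner.HasWeakRightGenerator (QMeixner.wienerTransition 0) t f
          (fun x => ∫ y in Ioo (-2 : ℝ) 2, QMeixner.freeIntegrand t f x y)) ∧
    -- both generators on polynomials
    (∀ t : ℝ, 0 < t → ∀ f : ℝ[X], ∃ g : ℝ[X],
        QMeixner.HasPolyLeftGenerator (QMeixner.wienerTransition 0) t f g ∧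
        QMeixner.HasPolyRightGenerator (QMeixner.wienerTransition 0) t f g ∧
        ∀ x : ℝ,
          IntegrableOn (QMeixner.freeIntegrand t (fun y => f.eval y) x) (Ioo (-2) 2) ∧
          g.eval x = ∫ y in Ioo (-2 : ℝ) 2, QMeixner.freeIntegrand t (fun y => f.eval y) x y) := by
  refine ⟨fun s t x hs hst => QMeixner.existsUnique_isOrthogonalityMeasure hs hst x, ?_, ?_⟩
  · rintro t ht f hf ⟨K, hK⟩
    refine ⟨QMeixner.integrableOn_freeIntegrand hf ht,
      ⟨⟨K, fun h h0 ht' x => ?_⟩, QMeixner.tendsto_leftQuotient_wienerTransition hf ht⟩,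
      ⟨⟨K, fun h h0 x => ?_⟩, QMeixner.tendsto_rightQuotient_wienerTransition hf ht⟩⟩
    · simpa only [QMeixner.leftQuotient, sub_sub_cancel] using
        QMeixner.abs_inv_mul_integral_wienerTransition_sub_le hf hK (sub_nonneg.2 ht')
          (sub_lt_self t h0) x
    · simpa only [QMeixner.rightQuotient, add_sub_cancel_left] using
        QMeixner.abs_inv_mul_integral_wienerTransition_sub_le hf hK ht.le
          (lt_add_of_pos_right t h0) x
  · intro t ht f
    have hf : ContDiff ℝ 2 fun y => f.eval y := by
      simpa using f.contDiff_aeval (𝕜 := ℝ) 2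
    obtain ⟨g, hg⟩ := QMeixner.exists_eval_eq_integral_freeIntegrand ht f
    refine ⟨g, fun x => ?_, fun x => ?_,
      fun x => ⟨QMeixner.integrableOn_freeIntegrand hf ht x, hg x⟩⟩
    · rw [hg]; exact QMeixner.tendsto_leftQuotient_wienerTransition hf ht x
    · rw [hg]; exact QMeixner.tendsto_rightQuotient_wienerTransition hf ht x
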